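/- Let $F$ be a field, let $n,k\geqslant 0$ be integers, and let $A=F[\sigma_1^{\pm1},\dots,\sigma_n^{\pm1}]$ act on the space $\mathcal{F}_{\mathbb{L}}$ of all functions $\mathbb{L}=\mathbb{Z}^n\to F$ by shifts, $(\sigma^z f)(x)=f(x+z)$. Let $\mathbb{S}\subset\mathbb{Z}^n$ be a sublattice (subgroup) of full rank $n$, let $A_S\subset A$ be the $F$-subalgebra generated by the monomials $\sigma^s$, $s\in\mathbb{S}$, and let it act by shifts on the space $\mathcal{F}_{\mathbb{S}}$ of all functions $\mathbb{S}\to F$. For a submodule $P\subset A^k$ let $\mathrm{Ker}_{\mathcal{F}_{\mathbb{L}}}(P)=\{f\in\mathcal{F}_{\mathbb{L}}^k : \sum_{j} p_jf_j=0 \text{ for all } p\in P\}$; define $\mathrm{Ker}_{\mathcal{F}_{\mathbb{S}}}(Q)$ in the same way for a submodule $Q\subset A_S^k$, and let $Q^e$ be the $A$-submodule of $A^k$ generated by $Q$. A system $\mathcal{B}$ on $X\in\{\mathbb{L},\mathbb{S}\}$ is *controllable* if there is a real $\rho>0$ such that $\mathcal{B}(T_1\cup T_2)=\mathcal{B}(T_1)\times\mathcal{B}(T_2)$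 for all subsets $T_1,T_2\subset X$ with $\|x_1-x_2\|_1>\rho$ for all $x_1\in T_1$, $x_2\in T_2$; here $\mathcal{B}(T)$ is the set of restrictions of the elements of $\mathcal{B}$ to $T$. A submodule $T$ of $A^k$ (respectively $A_S^k$) *defines an image representation* of a system $\mathcal{B}$ on $\mathbb{L}$ (respectively $\mathbb{S}$) if $\mathcal{B}$ is the image $\{Mg\}$ of the operator on tuples of signals given by a matrix $M$ with $k$ rows whose columns generate $T$. The *right annihilator* of a submodule $P$ is the submodule of all $r$ with $\sum_i p_ir_i=0$ for every $p\in P$. **Proposition 7.4.** Let $Q\subset A_S^k$ be a submodule. The system $\mathrm{Ker}_{\mathcal{F}_{\mathbb{S}}}(Q)$ is controllable if and only if its extension $\mathrm{Ker}_{\mathcal{F}_{\mathbb{L}}}(Q^e)$ is controllable. Moreover, for every submodule $T\subset A_S^k$, $T$ defines an image representation of $\mathrm{Ker}_{\mathcal{F}_{\mathbb{S}}}(Q)$ if and only if $T^e$ defines an image representation of $\mathrm{Ker}_{\mathcal{F}_{\mathbb{L}}}(Q^e)$; and $T$ is the right annihilator of $Q$ and defines an image representation of $\mathrm{Ker}_{\mathcal{F}_{\mathbb{S}}}(Q)$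 if and only if $T^e$ is the right annihilator of $Q^e$ and defines an image representation of $\mathrm{Ker}_{\mathcal{F}_{\mathbb{L}}}(Q^e)$. -/

import Mathlib

namespace NDSystem

/-- The ring of partial difference operators on a lattice `X`: the Laurent polynomial ring over `F`
whose monomials `σ^z` are the points `z` of `X`. For `X = ℤⁿ` it is
`A = F[σ₁, σ₁⁻¹, …, σₙ, σₙ⁻¹]`. For a sublattice `S` of `ℤⁿ` it is the ring `A_S` of difference
operators on `S`, which `incl` below identifies with the subalgebra of `A` generated by the
monomials corresponding to the points of `S`. -/
abbrev Op (F X : Type*) [Field F] [AddCommGroup X] : Type _ := AddMonoidAlgebra F X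

/-- The inclusion `A_S → A`; it maps the monomial `σ^s` of `A_S` to the monomial `σ^s` of `A`. -/
noncomputable def incl (F : Type*) [Field F] {n : ℕ} (S : Submodule ℤ (Fin n → ℤ)) :
    Op F S →ₐ[F] Op F (Fin n → ℤ) :=
  AddMonoidAlgebra.mapDomainAlgHom F F (S.subtype : S →+ (Fin n → ℤ))

theorem incl_injective (F : Type*) [Field F] {n : ℕ} (S : Submodule ℤ (Fin n → ℤ)) :
    Function.Injective (incl F S) :=
  AddMonoidAlgebra.mapDomain_injective Subtype.val_injective

/-- `A_S`, embedded in `A`, is the `F`-subalgebra generated by the monomials of `S`. -/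
theorem range_incl (F : Type*) [Field F] {n : ℕ} (S : Submodule ℤ (Fin n → ℤ)) :
    (incl F S).range =
      Algebra.adjoin F ((fun s : Fin n → ℤ => AddMonoidAlgebra.single s (1 : F)) '' (S : Set _)) := by
  apply le_antisymm
  · rintro _ ⟨a, rfl⟩
    induction a using AddMonoidAlgebra.induction_on with
    | of s =>
      refine Algebra.subset_adjoin ⟨s, s.2, ?_⟩
      simp [incl, AddMonoidAlgebra.mapDomain_single]
    | add a b ha hb => simpa using add_mem ha hb
    | smul c a ha => simpa using Subalgebra.smul_mem _ ha c
  · rw [Algebra.adjoin_le_iff]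
    rintro _ ⟨s, hs, rfl⟩
    exact ⟨AddMonoidAlgebra.single ⟨s, hs⟩ 1, by simp [incl, AddMonoidAlgebra.mapDomain_single]⟩

/-- The action of a difference operator on a signal by shifts:
`((∑ c_z σ^z) f)(x) = ∑ c_z f(x + z)`. -/
noncomputable def act {F X : Type*} [Field F] [AddCommGroup X] (a : Op F X) (f : X → F) : X → F :=
  fun x => ∑ z ∈ a.coeff.support, a.coeff z * f (x + z)

/-- The system `Ker(P)` on the lattice `X` defined by a submodule `P`: all `k`-tuples of signals on
`X` that satisfy every law in `P`. -/
def Ker {F X : Type*} [Field F] [AddCommGroup X] {k : ℕ}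
    (P : Submodule (Op F X) (Fin k → Op F X)) : Set (Fin k → X → F) :=
  {f | ∀ p ∈ P, ∑ j, act (p j) (f j) = 0}

/-- The extension `Q^e`: the `A`-submodule of `A^k` generated by `Q ⊆ A_S^k ⊆ A^k`. -/
noncomputable def extend {F : Type*} [Field F] {n k : ℕ} {S : Submodule ℤ (Fin n → ℤ)}
    (Q : Submodule (Op F S) (Fin k → Op F S)) :
    Submodule (Op F (Fin n → ℤ)) (Fin k → Op F (Fin n → ℤ)) :=
  Submodule.span _ ((fun q j => incl F S (q j)) '' (Q : Set (Fin k → Op F S)))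

/-- The `L₁` distance on `ℤⁿ`. -/
def l1dist {n : ℕ} (x y : Fin n → ℤ) : ℝ := ((∑ i, |x i - y i| : ℤ) : ℝ)

/-- Restriction of a signal to a subset. -/
def restr {F X : Type*} {k : ℕ} (T : Set X) (f : Fin k → X → F) : Fin k → T → F :=
  fun j x => f j x

/-- Controllability of a system `B` whose signals live on a set `X` of points of `ℤⁿ`, with `pos`
the inclusion of `X` in `ℤⁿ`: there is `ρ > 0` such that `B(T₁ ∪ T₂) = B(T₁) × B(T₂)` whenever the
`L₁` distance between `T₁` and `T₂` exceeds `ρ`, where `B(T)` is the set of restrictions to `T` of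
the trajectories of `B`. -/
def IsControllable {F X : Type*} {n k : ℕ} (pos : X → (Fin n → ℤ)) (B : Set (Fin k → X → F)) :
    Prop :=
  ∃ ρ : ℝ, 0 < ρ ∧ ∀ T₁ T₂ : Set X, (∀ x ∈ T₁, ∀ y ∈ T₂, ρ < l1dist (pos x) (pos y)) →
    restr (T₁ ∪ T₂) '' B =
      {h : Fin k → ↥(T₁ ∪ T₂) → F |
        (fun j (x : T₁) => h j ⟨x, Or.inl x.2⟩) ∈ restr T₁ '' B ∧
        (fun j (x : T₂) => h j ⟨x, Or.inr x.2⟩) ∈ restr T₂ '' B}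

/-- The operator on signals given by a `k × r` matrix of difference operators. -/
noncomputable def matrixAct {F X : Type*} [Field F] [AddCommGroup X] {k r : ℕ}
    (M : Matrix (Fin k) (Fin r) (Op F X)) (g : Fin r → X → F) : Fin k → X → F :=
  fun i => ∑ j, act (M i j) (g j)

/-- The submodule `T` defines an image representation for the system `B`: `B` is the image of the
operator given by a matrix whose columns generate `T`. The image depends on `T` only, not on the
generators. -/
def DefinesImageRep {F X : Type*} [Field F] [AddCommGroup X] {k : ℕ}
    (T : Submodule (Op F X) (Fin k → Op F X)) (B : Set (Fin k → X → F)) : Prop :=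
  ∃ (r : ℕ) (M : Matrix (Fin k) (Fin r) (Op F X)),
    Submodule.span (Op F X) (Set.range M.transpose) = T ∧ B = Set.range (matrixAct M)

/-- The right annihilator of `P`: all `r` with `∑ pᵢ rᵢ = 0` for every `p` in `P`, i.e. all
relations between the columns of a matrix whose rows generate `P`. -/
def rightAnnihilator {F X : Type*} [Field F] [AddCommGroup X] {k : ℕ}
    (P : Submodule (Op F X) (Fin k → Op F X)) : Submodule (Op F X) (Fin k → Op F X) where
  carrier := {r | ∀ p ∈ P, ∑ i, p i * r i = 0}
  zero_mem' := by simp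
  add_mem' := by
    intro a b ha hb p hp
    simp [mul_add, Finset.sum_add_distrib, ha p hp, hb p hp]
  smul_mem' := by
    intro c a ha p hp
    have h : ∑ i, p i * (c • a) i = c * ∑ i, p i * a i := by
      rw [Finset.mul_sum]
      exact Finset.sum_congr rfl fun i _ => by simp [mul_left_comm]
    rw [h, ha p hp, mul_zero]

end NDSystem

/-! Everything splits along the cosets of `S`. A signal on `ℤⁿ` is an arbitrary family of signals on
the cosets, each a copy of `S`, and operators from `A_S` act on each coset separately. Dually, `A`
is free over `A_S` on the monomials at coset representatives. Hence membership in `Ker(Q^e)`, in the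
image of a matrix over `A_S`, in `T^e` and in the right annihilator of `Q^e` can each be tested
coset by coset (`mem_Ker_extend_iff`, `mem_range_matrixAct_incl_iff`, `mem_extend_iff`,
`rightAnnihilator_extend`).

To pass from `S` to `ℤⁿ`, solutions on the cosets are glued. To return, a signal is extended by zero
and the slice at `0` is read off. Translations preserve distance, so the same `ρ` serves for both
controllability statements.

Slices are taken at every point `x`, not only at representatives: two slices in one coset differ by
a shift, and a choice is made only when gluing. -/

namespace NDSystem

open AddMonoidAlgebra

/-! ### Difference operators on signals, matrix images, controllability as patching -/

section Action

variable {F X : Type*} [Field F] [AddCommGroup X]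

theorem act_eq_sum (a : Op F X) (f : X → F) (x : X) :
    act a f x = a.coeff.sum fun z c => c * f (x + z) := rfl

@[simp]
theorem act_zero (f : X → F) : act (0 : Op F X) f = 0 := by
  funext x; simp [act]

theorem act_add (a b : Op F X) (f : X → F) : act (a + b) f = act a f + act b f := by
  funext x
  simp only [Pi.add_apply, act_eq_sum, coeff_add]
  exact Finsupp.sum_add_index' (by simp) (by intros; ring)

theorem act_single (z : X) (c : F) (f : X → F) (x : X) :
    act (single z c) f x = c * f (x + z) := by
  rw [act_eq_sum, coeff_single]
  exact Finsupp.sum_single_index (by simp)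

@[simp]
theorem act_zero_right (a : Op F X) : act a (0 : X → F) = 0 := by
  funext x; simp [act]

theorem act_add_right (a : Op F X) (f g : X → F) : act a (f + g) = act a f + act a g := by
  funext x
  simp [act, mul_add, Finset.sum_add_distrib]

theorem act_sum_right {ι : Type*} (s : Finset ι) (a : Op F X) (f : ι → X → F) :
    act a (∑ i ∈ s, f i) = ∑ i ∈ s, act a (f i) :=
  map_sum (AddMonoidHom.mk' (act a) (act_add_right a)) f s

theorem sum_act {ι : Type*} (s : Finset ι) (a : ι → Op F X) (f : X → F) :
    act (∑ i ∈ s, a i) f = ∑ i ∈ s, act (a i) f :=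
  map_sum (AddMonoidHom.mk' (fun a => act a f) fun a b => act_add a b f) a s

theorem act_mul (a b : Op F X) (f : X → F) : act (a * b) f = act a (act b f) := by
  induction a using AddMonoidAlgebra.induction_linear with
  | zero => simp
  | add a a' ha ha' => rw [add_mul, act_add, act_add, ha, ha']
  | single z c =>
    induction b using AddMonoidAlgebra.induction_linear with
    | zero => simp
    | add b b' hb hb' => rw [mul_add, act_add, act_add, act_add_right, hb, hb']
    | single w d =>
      funext x
      simp only [single_mul_single, act_single, add_assoc, mul_assoc]

theorem matrixAct_mul {k r t : ℕ} (M : Matrix (Fin k) (Fin r) (Op F X))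
    (N : Matrix (Fin r) (Fin t) (Op F X)) (g : Fin t → X → F) :
    matrixAct (M * N) g = matrixAct M (matrixAct N g) := by
  funext i
  simp only [matrixAct, Matrix.mul_apply, sum_act, act_sum_right, act_mul]
  exact Finset.sum_comm

/-- Writing each column of `N` as a combination of columns of `M` gives `N = M * C`, so the operator
of `N` factors through that of `M`. -/
theorem range_matrixAct_subset {k r t : ℕ} {M : Matrix (Fin k) (Fin r) (Op F X)}
    {N : Matrix (Fin k) (Fin t) (Op F X)}
    (h : Submodule.span (Op F X) (Set.range N.transpose) ≤
      Submodule.span (Op F X) (Set.range M.transpose)) :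
    Set.range (matrixAct N) ⊆ Set.range (matrixAct M) := by
  have hc : ∀ j, ∃ c : Fin r → Op F X, ∑ i, c i • M.transpose i = N.transpose j := fun j =>
    (Submodule.mem_span_range_iff_exists_fun _).1 (h (Submodule.subset_span ⟨j, rfl⟩))
  choose c hc using hc
  have hN : N = M * Matrix.of fun i j => c j i := by
    ext1 i j
    have := congrFun (hc j) i
    simp only [Finset.sum_apply, Pi.smul_apply, Matrix.transpose_apply, smul_eq_mul] at this
    rw [← this, Matrix.mul_apply]
    exact Finset.sum_congr rfl fun l _ => mul_comm _ _
  rintro _ ⟨g, rfl⟩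
  rw [hN, matrixAct_mul]
  exact ⟨_, rfl⟩

/-- The image of a matrix operator depends only on the module generated by the columns. -/
theorem range_matrixAct_eq {k r t : ℕ} {M : Matrix (Fin k) (Fin r) (Op F X)}
    {N : Matrix (Fin k) (Fin t) (Op F X)}
    (h : Submodule.span (Op F X) (Set.range M.transpose) =
      Submodule.span (Op F X) (Set.range N.transpose)) :
    Set.range (matrixAct M) = Set.range (matrixAct N) :=
  (range_matrixAct_subset h.le).antisymm (range_matrixAct_subset h.ge)

/-- Since `ρ > 0`, the sets `T₁` and `T₂` are disjoint, so any two trajectories prescribe a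
well-defined signal on the union. The product condition thus says that trajectories can be patched.
-/
theorem isControllable_iff {F : Type*} {n k : ℕ} {Y : Type*} (pos : Y → (Fin n → ℤ))
    (B : Set (Fin k → Y → F)) :
    IsControllable pos B ↔ ∃ ρ : ℝ, 0 < ρ ∧ ∀ T₁ T₂ : Set Y,
      (∀ x ∈ T₁, ∀ y ∈ T₂, ρ < l1dist (pos x) (pos y)) →
      ∀ f₁ ∈ B, ∀ f₂ ∈ B, ∃ f ∈ B,
        (∀ j, ∀ x ∈ T₁, f j x = f₁ j x) ∧ ∀ j, ∀ x ∈ T₂, f j x = f₂ j x := by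
  classical
  refine exists_congr fun ρ => and_congr_right fun hρ => forall_congr' fun T₁ =>
    forall_congr' fun T₂ => imp_congr_right fun hT => ⟨fun h f₁ hf₁ f₂ hf₂ => ?_, fun h => ?_⟩
  · have hdisj : ∀ x ∈ T₂, x ∉ T₁ := fun x hx₂ hx₁ => by
      have := hT x hx₁ x hx₂
      simp only [l1dist, sub_self, abs_zero, Finset.sum_const_zero, Int.cast_zero] at this
      linarith
    have hmem : (fun j (x : ↥(T₁ ∪ T₂)) => if (x : Y) ∈ T₁ then f₁ j x else f₂ j x) ∈
        restr (T₁ ∪ T₂) '' B := by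
      rw [h]
      refine ⟨⟨f₁, hf₁, ?_⟩, ⟨f₂, hf₂, ?_⟩⟩
      · funext j x
        simp [restr, x.2]
      · funext j x
        simp [restr, hdisj x x.2]
    obtain ⟨f, hf, hfe⟩ := hmem
    refine ⟨f, hf, fun j x hx => ?_, fun j x hx => ?_⟩
    · simpa [restr, hx] using congrFun (congrFun hfe j) ⟨x, Or.inl hx⟩
    · simpa [restr, hdisj x hx] using congrFun (congrFun hfe j) ⟨x, Or.inr hx⟩
  · ext g
    constructor
    · rintro ⟨f, hf, rfl⟩
      exact ⟨⟨f, hf, rfl⟩, ⟨f, hf, rfl⟩⟩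
    · rintro ⟨⟨f₁, hf₁, h₁⟩, ⟨f₂, hf₂, h₂⟩⟩
      obtain ⟨f, hf, hfe₁, hfe₂⟩ := h f₁ hf₁ f₂ hf₂
      refine ⟨f, hf, ?_⟩
      funext j ⟨x, hx⟩
      rcases hx with hx | hx
      · exact (hfe₁ j x hx).trans (congrFun (congrFun h₁ j) ⟨x, hx⟩)
      · exact (hfe₂ j x hx).trans (congrFun (congrFun h₂ j) ⟨x, hx⟩)

end Action

/-! ### Coset decomposition of signals -/

section Sublattice

variable {F : Type*} [Field F] {n : ℕ} {S : Submodule ℤ (Fin n → ℤ)}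

/-- The signal on the sublattice read off along the coset of `x`. -/
def slice (S : Submodule ℤ (Fin n → ℤ)) (x : Fin n → ℤ) (f : (Fin n → ℤ) → F) : S → F :=
  fun s => f (x + s)

/-- The operator on the sublattice formed by the coefficients in the coset of `x`. -/
noncomputable def opSlice (S : Submodule ℤ (Fin n → ℤ)) (x : Fin n → ℤ) (a : Op F (Fin n → ℤ)) :
    Op F S :=
  .ofCoeff (a.coeff.comapDomain (fun s : S => x + s)
    ((add_right_injective x).comp Subtype.val_injective).injOn)

/-- Extension of a signal on the sublattice by zero. -/
noncomputable def zeroExtend (f : S → F) : (Fin n → ℤ) → F :=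
  Function.extend Subtype.val f 0

theorem exists_coset_representatives (S : Submodule ℤ (Fin n → ℤ)) :
    ∃ rep : (Fin n → ℤ) → (Fin n → ℤ),
      (∀ x, x - rep x ∈ S) ∧ ∀ x y, x - y ∈ S → rep x = rep y := by
  refine ⟨fun x => (Submodule.Quotient.mk (p := S) x).out, fun x => ?_, fun x y h => ?_⟩
  · rw [← Submodule.Quotient.eq S]
    exact (Quotient.out_eq _).symm
  · simp only [(Submodule.Quotient.eq S).2 h]

/-- Signals given independently on the cosets of the sublattice can be glued. -/
theorem exists_glue {F ι : Type*} (S : Submodule ℤ (Fin n → ℤ))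
    (g : (Fin n → ℤ) → ι → S → F) :
    ∃ (rep : (Fin n → ℤ) → (Fin n → ℤ)) (G : ι → (Fin n → ℤ) → F),
      (∀ x, x - rep x ∈ S) ∧ ∀ x j, slice S (rep x) (G j) = g (rep x) j := by
  obtain ⟨rep, h₁, h₂⟩ := exists_coset_representatives S
  refine ⟨rep, fun j y => g (rep y) j ⟨y - rep y, h₁ y⟩, h₁, fun x j => ?_⟩
  funext s
  have h : rep (rep x + s) = rep x := h₂ _ _ (by
    have := S.sub_mem s.2 (h₁ x)
    rwa [show (s : Fin n → ℤ) - (x - rep x) = rep x + s - x by abel] at this)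
  -- The representative also occurs in a membership proof, so it is generalized to `r` before being
  -- replaced by `rep x`.
  have hs : ∀ r (hr : rep x + s - r ∈ S), r = rep x →
      g r j ⟨rep x + s - r, hr⟩ = g (rep x) j s := by
    rintro r hr rfl
    congr 1
    exact Subtype.ext (by simp)
  exact hs _ _ h

theorem slice_zero (S : Submodule ℤ (Fin n → ℤ)) (x : Fin n → ℤ) :
    slice S x (0 : (Fin n → ℤ) → F) = 0 := rfl

theorem slice_add (x : Fin n → ℤ) (f g : (Fin n → ℤ) → F) :
    slice S x (f + g) = slice S x f + slice S x g := rfl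

theorem slice_sum {ι : Type*} (s : Finset ι) (x : Fin n → ℤ) (f : ι → (Fin n → ℤ) → F) :
    slice S x (∑ i ∈ s, f i) = ∑ i ∈ s, slice S x (f i) :=
  map_sum (AddMonoidHom.mk' (slice S x) (slice_add x)) f s

theorem slice_injective {F : Type*} {f g : (Fin n → ℤ) → F} (h : ∀ x, slice S x f = slice S x g) : f = g := by
  funext x
  simpa [slice] using congrFun (h x) 0

theorem incl_single (s : S) (c : F) : incl F S (single s c) = single (s : Fin n → ℤ) c := by
  simp [incl, mapDomain_single]

theorem slice_act_incl (x : Fin n → ℤ) (a : Op F S) (f : (Fin n → ℤ) → F) :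
    slice S x (act (incl F S a) f) = act a (slice S x f) := by
  induction a using AddMonoidAlgebra.induction_linear with
  | zero => simp [slice_zero]
  | add a b ha hb => rw [map_add, act_add, act_add, slice_add, ha, hb]
  | single s c =>
    funext t
    simp [slice, incl_single, act_single, add_assoc]

theorem slice_zero_zeroExtend (f : S → F) : slice S 0 (zeroExtend f) = f := by
  funext s
  simp [slice, zeroExtend]

theorem slice_coe_zeroExtend (s : S) (f : S → F) :
    slice S s (zeroExtend f) = fun t => f (s + t) := by
  funext t
  exact Subtype.val_injective.extend_apply f 0 (s + t)

theorem slice_zeroExtend_of_notMem {x : Fin n → ℤ} (hx : x ∉ S) (f : S → F) :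
    slice S x (zeroExtend f) = 0 := by
  funext t
  refine Function.extend_apply' f (0 : (Fin n → ℤ) → F) _ ?_
  rintro ⟨s, hs⟩
  exact hx ((S.add_mem_iff_left t.2).1 (hs ▸ s.2))

/-! ### Coset decomposition of operators -/

@[simp]
theorem coeff_opSlice (x : Fin n → ℤ) (a : Op F (Fin n → ℤ)) (s : S) :
    (opSlice S x a).coeff s = a.coeff (x + s) := rfl

theorem opSlice_add (x : Fin n → ℤ) (a b : Op F (Fin n → ℤ)) :
    opSlice S x (a + b) = opSlice S x a + opSlice S x b := by
  ext s; simp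

@[simp]
theorem opSlice_zero (x : Fin n → ℤ) : opSlice S x (0 : Op F (Fin n → ℤ)) = 0 := by
  ext s; simp

theorem opSlice_sum {ι : Type*} (s : Finset ι) (x : Fin n → ℤ) (a : ι → Op F (Fin n → ℤ)) :
    opSlice S x (∑ i ∈ s, a i) = ∑ i ∈ s, opSlice S x (a i) :=
  map_sum (AddMonoidHom.mk' (opSlice S x) (opSlice_add x)) a s

theorem opSlice_injective {a b : Op F (Fin n → ℤ)} (h : ∀ x, opSlice S x a = opSlice S x b) :
    a = b := by
  ext x
  have := congrArg (fun c => c.coeff 0) (h x)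
  simpa using this

/-- Multiplication by an element of `A_S` does not mix cosets, so slicing is `A_S`-linear. -/
theorem opSlice_incl_mul (x : Fin n → ℤ) (q : Op F S) (a : Op F (Fin n → ℤ)) :
    opSlice S x (incl F S q * a) = q * opSlice S x a := by
  induction q using AddMonoidAlgebra.induction_linear with
  | zero => simp
  | add q q' hq hq' => rw [map_add, add_mul, add_mul, opSlice_add, hq, hq']
  | single s c =>
    ext t
    simp [incl_single, coeff_single_mul_apply, add_left_comm]

theorem opSlice_zero_one : opSlice S 0 (1 : Op F (Fin n → ℤ)) = 1 := by
  classical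
  ext s
  simp [one_def, Finsupp.single_apply, eq_comm]

theorem opSlice_zero_incl (q : Op F S) : opSlice S 0 (incl F S q) = q := by
  simpa [opSlice_zero_one] using opSlice_incl_mul 0 q (1 : Op F (Fin n → ℤ))

theorem coeff_incl_coe (q : Op F S) (s : S) : (incl F S q).coeff s = q.coeff s := by
  simpa using congrArg (fun c => c.coeff s) (opSlice_zero_incl q)

theorem coeff_incl_of_notMem (q : Op F S) {x : Fin n → ℤ} (hx : x ∉ S) :
    (incl F S q).coeff x = 0 := by
  classical
  induction q using AddMonoidAlgebra.induction_linear with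
  | zero => simp
  | add q q' hq hq' => simp [hq, hq']
  | single s c =>
    rw [incl_single, coeff_single, Finsupp.single_apply, if_neg]
    rintro rfl
    exact hx s.2

/-- `A` is generated over `A_S` by the monomials at coset representatives. -/
theorem eq_sum_opSlice {rep : (Fin n → ℤ) → (Fin n → ℤ)} (h₁ : ∀ x, x - rep x ∈ S)
    (h₂ : ∀ x y, x - y ∈ S → rep x = rep y) (a : Op F (Fin n → ℤ)) (D : Finset (Fin n → ℤ))
    (hD : ∀ x ∈ a.coeff.support, x ∈ D) :
    a = ∑ r ∈ D.image rep, single r (1 : F) * incl F S (opSlice S r a) := by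
  ext x
  simp only [coeff_sum, Finsupp.finsetSum_apply, coeff_single_mul_apply, one_mul]
  -- At `x` only the summand `r = rep x` can contribute, the others being supported on different
  -- cosets.
  by_cases hx : rep x ∈ D.image rep
  · rw [Finset.sum_eq_single_of_mem _ hx]
    · have := coeff_incl_coe (opSlice S (rep x) a) ⟨x - rep x, h₁ x⟩
      simp only [coeff_opSlice, add_sub_cancel] at this
      rw [neg_add_eq_sub, this]
    · intro r hr hne
      obtain ⟨y, -, rfl⟩ := Finset.mem_image.1 hr
      refine coeff_incl_of_notMem _ fun hmem => hne (h₂ _ _ ?_)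
      have := S.neg_mem (S.add_mem hmem (S.neg_mem (h₁ y)))
      rwa [show -(-rep y + x + -(y - rep y)) = y - x by abel] at this
  · have hax : a.coeff x = 0 := by
      by_contra hne
      exact hx (Finset.mem_image_of_mem _ (hD x (Finsupp.mem_support_iff.2 hne)))
    rw [hax, Finset.sum_eq_zero]
    intro r hr
    obtain ⟨y, hy, rfl⟩ := Finset.mem_image.1 hr
    refine coeff_incl_of_notMem _ fun hmem => hx ?_
    have := S.neg_mem (S.add_mem hmem (S.neg_mem (h₁ y)))
    rw [show -(-rep y + x + -(y - rep y)) = y - x by abel] at this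
    exact h₂ _ _ this ▸ hr

/-! ### Extended modules, annihilators and kernels -/

variable {k : ℕ}

theorem incl_mem_extend {T : Submodule (Op F S) (Fin k → Op F S)} {t : Fin k → Op F S}
    (ht : t ∈ T) : (fun j => incl F S (t j)) ∈ extend T :=
  Submodule.subset_span ⟨t, ht, rfl⟩

theorem mem_extend_iff (T : Submodule (Op F S) (Fin k → Op F S))
    (a : Fin k → Op F (Fin n → ℤ)) :
    a ∈ extend T ↔ ∀ x, (fun j => opSlice S x (a j)) ∈ T := by
  classical
  constructor
  · intro ha x
    -- Elements of the span are sums of `c • t` with `t` a generator. For these, the slice of the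
    -- product is `t` scaled by the slice of `c`.
    induction ha using Submodule.closure_induction with
    | zero =>
      convert T.zero_mem using 1
      funext j
      exact opSlice_zero x
    | add a b _ _ ha hb =>
      convert T.add_mem ha hb using 1
      funext j
      exact opSlice_add x _ _
    | smul_mem c _ h =>
      obtain ⟨t, ht, rfl⟩ := h
      convert T.smul_mem (opSlice S x c) ht using 1
      funext j
      simp only [Pi.smul_apply, smul_eq_mul]
      rw [mul_comm c, opSlice_incl_mul, mul_comm]
  · intro h
    obtain ⟨rep, h₁, h₂⟩ := exists_coset_representatives S
    -- One finite set containing the supports of all coordinates allows the same sum over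
    -- representatives in each of them.
    let D : Finset (Fin n → ℤ) := Finset.univ.biUnion fun j => (a j).coeff.support
    have ha : a = ∑ r ∈ D.image rep,
        single r (1 : F) • fun j => incl F S (opSlice S r (a j)) := by
      funext j
      simp only [Finset.sum_apply, Pi.smul_apply, smul_eq_mul]
      exact eq_sum_opSlice h₁ h₂ (a j) D fun x hx => Finset.mem_biUnion.2 ⟨j, Finset.mem_univ _, hx⟩
    rw [ha]
    exact Submodule.sum_mem _ fun r _ => Submodule.smul_mem _ _ (incl_mem_extend (h r))

theorem incl_mem_extend_iff (T : Submodule (Op F S) (Fin k → Op F S)) (t : Fin k → Op F S) :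
    (fun j => incl F S (t j)) ∈ extend T ↔ t ∈ T := by
  refine ⟨fun h => ?_, incl_mem_extend⟩
  simpa [opSlice_zero_incl] using (mem_extend_iff T _).1 h 0

/-- The slice at `0` recovers `T` as the part of `T^e` with entries in `A_S`. -/
theorem extend_injective :
    Function.Injective (extend : Submodule (Op F S) (Fin k → Op F S) → _) := fun T T' h => by
  ext t
  rw [← incl_mem_extend_iff, h, incl_mem_extend_iff]

theorem mem_rightAnnihilator {X : Type*} [AddCommGroup X]
    {P : Submodule (Op F X) (Fin k → Op F X)} {r : Fin k → Op F X} :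
    r ∈ rightAnnihilator P ↔ ∀ p ∈ P, ∑ i, p i * r i = 0 := Iff.rfl

theorem rightAnnihilator_extend (Q : Submodule (Op F S) (Fin k → Op F S)) :
    rightAnnihilator (extend Q) = extend (rightAnnihilator Q) := by
  ext a
  rw [mem_extend_iff]
  simp only [mem_rightAnnihilator]
  constructor
  · intro h x q hq
    have := congrArg (opSlice S x) (h _ (incl_mem_extend hq))
    simpa only [opSlice_sum, opSlice_incl_mul, opSlice_zero] using this
  · intro h p hp
    induction hp using Submodule.span_induction with
    | mem p hp =>
      obtain ⟨q, hq, rfl⟩ := hp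
      refine opSlice_injective (S := S) fun x => ?_
      simpa only [opSlice_sum, opSlice_incl_mul, opSlice_zero] using h x q hq
    | zero => simp
    | add p p' _ _ hp hp' => simp [add_mul, Finset.sum_add_distrib, hp, hp']
    | smul c p _ hp => simp [mul_assoc, ← Finset.mul_sum, hp]

/-- A tuple of signals satisfies the extended laws if and only if its restriction to each coset
satisfies the given ones. -/
theorem mem_Ker_extend_iff (Q : Submodule (Op F S) (Fin k → Op F S))
    (f : Fin k → (Fin n → ℤ) → F) :
    f ∈ Ker (extend Q) ↔ ∀ x, (fun j => slice S x (f j)) ∈ Ker Q := by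
  constructor
  · intro h x q hq
    have := congrArg (slice S x) (h _ (incl_mem_extend hq))
    simpa only [slice_sum, slice_act_incl, slice_zero] using this
  · intro h p hp
    induction hp using Submodule.span_induction with
    | mem p hp =>
      obtain ⟨q, hq, rfl⟩ := hp
      refine slice_injective (S := S) fun x => ?_
      simpa only [slice_sum, slice_act_incl, slice_zero] using h x q hq
    | zero => simp
    | add p p' _ _ hp hp' => simp [act_add, Finset.sum_add_distrib, hp, hp']
    | smul c p _ hp => simp [act_mul, ← act_sum_right, hp]

/-! ### Controllability -/

theorem shift_mem_Ker {X : Type*} [AddCommGroup X] {P : Submodule (Op F X) (Fin k → Op F X)}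
    {f : Fin k → X → F} (hf : f ∈ Ker P) (s : X) : (fun j t => f j (s + t)) ∈ Ker P := by
  intro p hp
  funext t
  have := congrFun (hf p hp) (s + t)
  simpa [act, add_assoc] using this

theorem zeroExtend_mem_Ker_extend {Q : Submodule (Op F S) (Fin k → Op F S)}
    {f : Fin k → S → F} (hf : f ∈ Ker Q) : (fun j => zeroExtend (f j)) ∈ Ker (extend Q) := by
  rw [mem_Ker_extend_iff]
  intro x
  by_cases hx : x ∈ S
  · have := shift_mem_Ker hf (⟨x, hx⟩ : S)
    convert this using 1
    funext j
    exact slice_coe_zeroExtend ⟨x, hx⟩ (f j)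
  · intro q _
    simp [slice_zeroExtend_of_notMem hx]

theorem isControllable_Ker_extend_iff (Q : Submodule (Op F S) (Fin k → Op F S)) :
    IsControllable (Subtype.val : S → (Fin n → ℤ)) (Ker Q) ↔
      IsControllable (id : (Fin n → ℤ) → (Fin n → ℤ)) (Ker (extend Q)) := by
  simp only [isControllable_iff]
  refine exists_congr fun ρ => and_congr_right fun _ => ⟨fun h T₁ T₂ hT f₁ hf₁ f₂ hf₂ => ?_,
    fun h T₁ T₂ hT f₁ hf₁ f₂ hf₂ => ?_⟩
  -- Patch on each coset separately: the traces of `T₁` and `T₂`, translated by `-x`, are still more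
  -- than `ρ` apart.
  · have hg : ∀ x : Fin n → ℤ, ∃ f ∈ Ker Q,
        (∀ j, ∀ s ∈ {s : S | x + s ∈ T₁}, f j s = slice S x (f₁ j) s) ∧
        ∀ j, ∀ s ∈ {s : S | x + s ∈ T₂}, f j s = slice S x (f₂ j) s := fun x =>
      h {s : S | x + s ∈ T₁} {s : S | x + s ∈ T₂}
        (fun s hs t ht => by simpa [l1dist] using hT _ hs _ ht)
        _ ((mem_Ker_extend_iff Q f₁).1 hf₁ x) _ ((mem_Ker_extend_iff Q f₂).1 hf₂ x)
    choose g hgK hg₁ hg₂ using hg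
    obtain ⟨rep, G, hrep, hG⟩ := exists_glue S g
    have hGx : ∀ x j, G j x = g (rep x) j ⟨x - rep x, hrep x⟩ := fun x j => by
      rw [← hG]; simp [slice]
    refine ⟨G, (mem_Ker_extend_iff Q G).2 fun x => ?_, fun j x hx => ?_, fun j x hx => ?_⟩
    -- Gluing controls the slice at `rep x` only; the slice at `x` is its shift by `x - rep x`.
    · have := shift_mem_Ker (hgK (rep x)) (⟨x - rep x, hrep x⟩ : S)
      simp only [← hG] at this
      convert this using 1
      funext j s
      simp [slice, ← add_assoc]
    · rw [hGx, hg₁ _ _ _ (by simpa using hx)]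
      simp [slice]
    · rw [hGx, hg₂ _ _ _ (by simpa using hx)]
      simp [slice]
  -- Extend both trajectories by zero, patch them on `ℤⁿ`, and take the slice at `0`.
  · obtain ⟨f, hf, h₁, h₂⟩ := h (Subtype.val '' T₁) (Subtype.val '' T₂)
      (by rintro _ ⟨s, hs, rfl⟩ _ ⟨t, ht, rfl⟩; exact hT s hs t ht)
      _ (zeroExtend_mem_Ker_extend hf₁) _ (zeroExtend_mem_Ker_extend hf₂)
    refine ⟨_, (mem_Ker_extend_iff Q f).1 hf 0, fun j s hs => ?_, fun j s hs => ?_⟩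
    · have := h₁ j s ⟨s, hs, rfl⟩
      simpa [slice, zeroExtend, Subtype.val_injective.extend_apply] using this
    · have := h₂ j s ⟨s, hs, rfl⟩
      simpa [slice, zeroExtend, Subtype.val_injective.extend_apply] using this

/-! ### Image representations -/

theorem slice_matrixAct_incl {r : ℕ} (x : Fin n → ℤ) (M : Matrix (Fin k) (Fin r) (Op F S))
    (g : Fin r → (Fin n → ℤ) → F) (i : Fin k) :
    slice S x (matrixAct (M.map (incl F S)) g i) = matrixAct M (fun j => slice S x (g j)) i := by
  simp only [matrixAct, slice_sum, Matrix.map_apply, slice_act_incl]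

/-- Preimages may be chosen independently on the cosets and glued. Those at representatives suffice,
as `x` is the point `x - rep x` of the slice at `rep x`. -/
theorem mem_range_matrixAct_incl_iff {r : ℕ} (M : Matrix (Fin k) (Fin r) (Op F S))
    (f : Fin k → (Fin n → ℤ) → F) :
    f ∈ Set.range (matrixAct (M.map (incl F S))) ↔
      ∀ x, (fun j => slice S x (f j)) ∈ Set.range (matrixAct M) := by
  constructor
  · rintro ⟨g, rfl⟩ x
    exact ⟨_, funext fun i => (slice_matrixAct_incl x M g i).symm⟩
  · intro h
    choose g hg using h
    obtain ⟨rep, G, hrep, hG⟩ := exists_glue S g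
    refine ⟨G, ?_⟩
    funext i x
    have h₁ := slice_matrixAct_incl (rep x) M G i
    simp only [hG] at h₁
    have h₂ := congrFun (h₁.trans (congrFun (hg (rep x)) i)) ⟨x - rep x, hrep x⟩
    simpa [slice] using h₂

theorem span_range_transpose_incl {r : ℕ} (M : Matrix (Fin k) (Fin r) (Op F S)) :
    Submodule.span (Op F (Fin n → ℤ)) (Set.range (M.map (incl F S)).transpose) =
      extend (Submodule.span (Op F S) (Set.range M.transpose)) := by
  apply le_antisymm
  · rw [Submodule.span_le]
    rintro _ ⟨j, rfl⟩
    exact incl_mem_extend (t := M.transpose j) (Submodule.subset_span ⟨j, rfl⟩)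
  · rw [extend, Submodule.span_le]
    rintro _ ⟨t, ht, rfl⟩
    obtain ⟨c, rfl⟩ := (Submodule.mem_span_range_iff_exists_fun _).1 ht
    refine (Submodule.mem_span_range_iff_exists_fun _).2 ⟨fun j => incl F S (c j), ?_⟩
    funext i
    simp

/-- `S` is a finitely generated group, so `A_S` is a finitely generated `F`-algebra, hence
Noetherian. -/
theorem exists_matrix_of_submodule (T : Submodule (Op F S) (Fin k → Op F S)) :
    ∃ (r : ℕ) (M : Matrix (Fin k) (Fin r) (Op F S)),
      Submodule.span (Op F S) (Set.range M.transpose) = T := by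
  have : AddMonoid.FG S := AddGroup.fg_iff_addMonoid_fg.1
    (Module.Finite.iff_addGroup_fg.1 inferInstance)
  have : IsNoetherianRing (Op F S) := Algebra.FiniteType.isNoetherianRing F _
  obtain ⟨r, c, hc⟩ := Submodule.fg_iff_exists_fin_generating_family.1 (IsNoetherian.noetherian T)
  exact ⟨r, (Matrix.of c).transpose, hc⟩

/-- Independence of the generators lets one fixed `M` decide the question, and this same `M` can be
carried over to `A`. -/
theorem definesImageRep_iff_range_eq {X : Type*} [AddCommGroup X] {r : ℕ}
    (M : Matrix (Fin k) (Fin r) (Op F X)) (B : Set (Fin k → X → F)) :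
    DefinesImageRep (Submodule.span (Op F X) (Set.range M.transpose)) B ↔
      B = Set.range (matrixAct M) := by
  refine ⟨?_, fun h => ⟨r, M, rfl, h⟩⟩
  rintro ⟨t, N, hN, rfl⟩
  exact range_matrixAct_eq hN

theorem Ker_eq_range_iff {r : ℕ} (Q : Submodule (Op F S) (Fin k → Op F S))
    (M : Matrix (Fin k) (Fin r) (Op F S)) :
    Ker Q = Set.range (matrixAct M) ↔
      Ker (extend Q) = Set.range (matrixAct (M.map (incl F S))) := by
  constructor
  · intro h
    ext f
    rw [mem_Ker_extend_iff, mem_range_matrixAct_incl_iff, h]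
  · intro h
    ext f
    constructor
    · intro hf
      have := zeroExtend_mem_Ker_extend hf
      rw [h, mem_range_matrixAct_incl_iff] at this
      simpa only [slice_zero_zeroExtend] using this 0
    · rintro ⟨g, rfl⟩
      have : matrixAct (M.map (incl F S)) (fun j => zeroExtend (g j)) ∈ Ker (extend Q) :=
        h ▸ ⟨_, rfl⟩
      have := (mem_Ker_extend_iff Q _).1 this 0
      simpa only [slice_matrixAct_incl, slice_zero_zeroExtend] using this

theorem definesImageRep_extend_iff (Q T : Submodule (Op F S) (Fin k → Op F S)) :
    DefinesImageRep T (Ker Q) ↔ DefinesImageRep (extend T) (Ker (extend Q)) := by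
  obtain ⟨r, M, rfl⟩ := exists_matrix_of_submodule T
  rw [← span_range_transpose_incl, definesImageRep_iff_range_eq, definesImageRep_iff_range_eq,
    Ker_eq_range_iff]

end Sublattice

end NDSystem

theorem proposition7p4 {F : Type*} [Field F] {n k : ℕ}
    (S : Submodule ℤ (Fin n → ℤ)) (hS : Module.finrank ℤ S = n)
    (Q : Submodule (NDSystem.Op F S) (Fin k → NDSystem.Op F S)) :
    (NDSystem.IsControllable (Subtype.val : S → (Fin n → ℤ)) (NDSystem.Ker Q) ↔
      NDSystem.IsControllable (id : (Fin n → ℤ) → (Fin n → ℤ))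
        (NDSystem.Ker (NDSystem.extend Q))) ∧
    ∀ T : Submodule (NDSystem.Op F S) (Fin k → NDSystem.Op F S),
      (NDSystem.DefinesImageRep T (NDSystem.Ker Q) ↔
        NDSystem.DefinesImageRep (NDSystem.extend T) (NDSystem.Ker (NDSystem.extend Q))) ∧
      ((NDSystem.DefinesImageRep T (NDSystem.Ker Q) ∧ T = NDSystem.rightAnnihilator Q) ↔
        (NDSystem.DefinesImageRep (NDSystem.extend T) (NDSystem.Ker (NDSystem.extend Q)) ∧
          NDSystem.extend T = NDSystem.rightAnnihilator (NDSystem.extend Q))) := by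
  refine ⟨NDSystem.isControllable_Ker_extend_iff Q, fun T =>
    ⟨NDSystem.definesImageRep_extend_iff Q T, ?_⟩⟩
  rw [NDSystem.definesImageRep_extend_iff Q T, NDSystem.rightAnnihilator_extend,
    NDSystem.extend_injective.eq_iff]
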